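/- Let $(X,\mathcal A,\mu)$ be an arbitrary measure space, let $p\in[1,\infty)$ be a real number and let $m$ be a natural number. Let $L^p_\mu(X)$ be the Banach space of real-valued measurable functions on $X$ (modulo equality $\mu$-almost everywhere) with finite norm $\|f\|_p=\left(\int_X|f|^p\,d\mu\right)^{1/p}$, and let $(L^p_\mu(X))^m$ be the space of $m$-tuples $u=(u^{(1)},\dots,u^{(m)})$ of elements of $L^p_\mu(X)$ with the norm $\|u\|_p=\left(\sum_{j=1}^m\|u^{(j)}\|_p^p\right)^{1/p}$. Let $q=p/(p-1)$ if $p>1$ and $q=\infty$ if $p=1$. Let $u_i=(u_i^{(1)},\dots,u_i^{(m)})$, $i=1,2,\dots$, be a sequence in $(L^p_\mu(X))^m$ that converges weakly, componentwise, to $u=(u^{(1)},\dots,u^{(m)})\in(L^p_\mu(X))^m$, that is, $$\lim_{i\to\infty}\int_X u_i^{(j)}\,v\,d\mu=\int_X u^{(j)}\,v\,d\mu\qquad\text{for all } v\in L^q_\mu(X)\text{ and } j=1,\dots,m.$$ Then $\{u_i\}$ has a subsequence $\{u_{i_r}\}_{r\ge1}$ whose arithmetic means converge strongly to $u$ in $(L^p_\mu(X))^m$: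 $$\lim_{k\to\infty}\left\|\frac1k\sum_{r=1}^k u_{i_r}-u\right\|_p=0 .$$ -/

import Mathlib

open Filter Topology MeasureTheory
open scoped ENNReal

/-- The Banach space `(L^p_μ(X))^m` of `m`-tuples of real `L^p` functions, with the norm
`‖u‖ = (∑ j, ‖u j‖_p ^ p) ^ (1 / p)`. -/
abbrev LpVec {X : Type*} [MeasurableSpace X] (m : ℕ) (p : ℝ≥0∞) (μ : Measure X) : Type _ :=
  PiLp p (fun _ : Fin m => Lp ℝ p μ)

/-- Weak convergence of a sequence in `L^p_μ(X)`, `1 ≤ p < ∞`: convergence of the integrals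
against every function in `L^q_μ(X)`. Here `q = ENNReal.conjExponent p = 1 + (p - 1)⁻¹`, which is
`p / (p - 1)` for `1 < p < ∞` and `∞` for `p = 1`. -/
def LpWeakTendsto {X : Type*} [MeasurableSpace X] {p : ℝ≥0∞} {μ : Measure X}
    (f : ℕ → Lp ℝ p μ) (g : Lp ℝ p μ) : Prop :=
  ∀ v : Lp ℝ (ENNReal.conjExponent p) μ,
    Tendsto (fun i => ∫ x, f i x * v x ∂μ) atTop (𝓝 (∫ x, g x * v x ∂μ))

/-- Weak convergence of a sequence in `(L^p_μ(X))^m`: every component converges weakly. -/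
def LpVecWeakTendsto {X : Type*} [MeasurableSpace X] {m : ℕ} {p : ℝ≥0∞} {μ : Measure X}
    (u : ℕ → LpVec m p μ) (u₀ : LpVec m p μ) : Prop :=
  ∀ j : Fin m, LpWeakTendsto (fun i => u i j) (u₀ j)

/-! After subtracting the limit, let `f i` tend weakly to zero. Choose the indices one at a time so
that each new term is almost orthogonal to the derivative of a convex functional at the current
partial sum `s`; the functional then grows too slowly for the means to stay away from zero.

For `1 < p` the functional is `‖s‖ ^ p`, with derivative `p * rpowDual p s` in the dual space. By
`exists_abs_add_rpow_le` and boundedness of `f`, each of the first `k` steps adds at most `B + 2 * ε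
* M ^ p * k ^ (p - 1)`, so `‖s k‖ ^ p = o(k ^ p)`.

For `p = 1` the functional is `∫ √(K ^ 2 + s ^ 2)`, whose derivative `s / √(K ^ 2 + s ^ 2)` is
bounded by one. The second-order error is small by equi-integrability, which comes from Baire's
theorem. An integrable weight reduces an arbitrary measure to a finite one.

In both cases the requirement on a new index is a lower bound `N` depending on the finite set of
earlier indices. Such bounds can be maximized over the `m` components, so one subsequence serves all
of them. -/

/-! ### Scalar inequalities for `|a + b| ^ p`, and the choice of indices -/

/-- The derivative of `|a| ^ p / p`, the duality map of `L^p`. -/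
noncomputable def rpowDual (p a : ℝ) : ℝ := a * |a| ^ (p - 2)

lemma mul_rpowDual {p : ℝ} (hp : 0 < p) (a : ℝ) : a * rpowDual p a = |a| ^ p := by
  rcases eq_or_ne a 0 with rfl | ha
  · simp [rpowDual, Real.zero_rpow hp.ne']
  · rw [rpowDual, ← mul_assoc, ← abs_mul_abs_self, ← sq, ← Real.rpow_natCast,
      ← Real.rpow_add (abs_pos.2 ha)]
    norm_num

lemma abs_rpowDual {p : ℝ} (hp : 1 < p) (a : ℝ) : |rpowDual p a| = |a| ^ (p - 1) := by
  rcases eq_or_ne a 0 with rfl | ha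
  · simp [rpowDual, Real.zero_rpow (sub_pos.2 hp).ne']
  · rw [rpowDual, abs_mul, abs_of_nonneg (Real.rpow_nonneg (abs_nonneg a) _)]
    nth_rewrite 1 [← Real.rpow_one |a|]
    rw [← Real.rpow_add (abs_pos.2 ha)]
    ring_nf

lemma measurable_rpowDual (p : ℝ) : Measurable (rpowDual p) := by
  unfold rpowDual
  fun_prop

/-- Near zero this is differentiability of `(1 + t) ^ p`; for `|t|` bounded below, a multiple of
`|t| ^ p` dominates everything else. The bound `1 ≤ C` serves the case `a = 0` of the homogeneous
version. -/
lemma exists_abs_one_add_rpow_le {p : ℝ} (hp : 1 < p) {ε : ℝ} (hε : 0 < ε) :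
    ∃ C : ℝ, 1 ≤ C ∧ ∀ t : ℝ, |1 + t| ^ p ≤ 1 + p * t + ε * |t| + C * |t| ^ p := by
  have hd : HasDerivAt (fun t : ℝ => (1 + t) ^ p) p 0 := by
    have := ((hasDerivAt_id (0 : ℝ)).const_add 1).rpow_const (p := p) (by simp)
    simpa using this
  have h1 := (hasDerivAt_iff_isLittleO.1 hd).def hε
  obtain ⟨δ, hδ, hball⟩ := Metric.eventually_nhds_iff.1 h1
  set d := min δ (1 / 2)
  have hdpos : 0 < d := lt_min hδ (by norm_num)
  refine ⟨max 1 ((d⁻¹ + 1) ^ p + p * d⁻¹ ^ (p - 1)), le_max_left _ _, fun t => ?_⟩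
  have htp : 0 ≤ |t| ^ p := by positivity
  rcases lt_or_ge |t| d with ht | ht
  · have h2 := hball (y := t) (by simpa [Real.dist_eq] using ht.trans_le (min_le_left _ _))
    have h3 : 0 ≤ 1 + t := by
      have := (abs_lt.1 (ht.trans_le (min_le_right _ _))).1
      linarith
    simp only [sub_zero, Real.norm_eq_abs, add_zero, Real.one_rpow, smul_eq_mul] at h2
    rw [abs_of_nonneg h3]
    have h4 := (abs_le.1 h2).2
    have : 0 ≤ max 1 ((d⁻¹ + 1) ^ p + p * d⁻¹ ^ (p - 1)) * |t| ^ p := by positivity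
    linarith
  · have ht0 : 0 < |t| := hdpos.trans_le ht
    have hdt : 1 ≤ d⁻¹ * |t| := by
      rw [inv_mul_eq_div]; exact (one_le_div hdpos).2 ht
    have h1 : |1 + t| ^ p ≤ (d⁻¹ + 1) ^ p * |t| ^ p := by
      rw [← Real.mul_rpow (by positivity) (abs_nonneg _)]
      refine Real.rpow_le_rpow (abs_nonneg _) ?_ (by linarith)
      calc |1 + t| ≤ |1| + |t| := abs_add_le _ _
        _ ≤ (d⁻¹ + 1) * |t| := by rw [abs_one]; linarith
    have h2 : |t| ≤ d⁻¹ ^ (p - 1) * |t| ^ p := by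
      have h3 : 1 ≤ (d⁻¹ * |t|) ^ (p - 1) := Real.one_le_rpow hdt (by linarith)
      rw [Real.mul_rpow (by positivity) (abs_nonneg _)] at h3
      have h4 : |t| ^ p = |t| ^ (p - 1) * |t| := by
        nth_rewrite 3 [← Real.rpow_one |t|]
        rw [← Real.rpow_add ht0]; ring_nf
      rw [h4, ← mul_assoc]
      nlinarith
    have h3 : -(p * t) ≤ p * (d⁻¹ ^ (p - 1) * |t| ^ p) := by
      have : -t ≤ |t| := neg_le_abs t
      nlinarith
    have h4 : ((d⁻¹ + 1) ^ p + p * d⁻¹ ^ (p - 1)) * |t| ^ p ≤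
        max 1 ((d⁻¹ + 1) ^ p + p * d⁻¹ ^ (p - 1)) * |t| ^ p :=
      mul_le_mul_of_nonneg_right (le_max_right _ _) htp
    nlinarith [mul_nonneg hε.le ht0.le]

lemma exists_abs_add_rpow_le {p : ℝ} (hp : 1 < p) {ε : ℝ} (hε : 0 < ε) :
    ∃ C : ℝ, 0 ≤ C ∧ ∀ a b : ℝ,
      |a + b| ^ p ≤ |a| ^ p + p * (rpowDual p a * b) + ε * (|a| ^ (p - 1) * |b|) + C * |b| ^ p := by
  obtain ⟨C, hC, h⟩ := exists_abs_one_add_rpow_le hp hε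
  refine ⟨C, by linarith, fun a b => ?_⟩
  rcases eq_or_ne a 0 with rfl | ha
  · have : 0 ≤ |b| ^ p := by positivity
    simp only [zero_add, abs_zero, rpowDual, zero_mul, mul_zero,
      Real.zero_rpow (sub_pos.2 hp).ne', Real.zero_rpow (by linarith : p ≠ 0)]
    nlinarith
  · have h1 := mul_le_mul_of_nonneg_left (h (b / a)) (by positivity : 0 ≤ |a| ^ p)
    have ha' : 0 < |a| := abs_pos.2 ha
    have e1 : |a| ^ p * |1 + b / a| ^ p = |a + b| ^ p := by
      rw [← Real.mul_rpow (abs_nonneg _) (abs_nonneg _), ← abs_mul]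
      congr 2
      field_simp
    have e2 : |a| ^ p * |b / a| ^ p = |b| ^ p := by
      rw [← Real.mul_rpow (abs_nonneg _) (abs_nonneg _), ← abs_mul]
      congr 2
      field_simp
    have e3 : |a| ^ p * (b / a) = rpowDual p a * b := by
      rw [← mul_rpowDual (by linarith) a]; field_simp
    have e4 : |a| ^ p * |b / a| = |a| ^ (p - 1) * |b| := by
      rw [abs_div, Real.rpow_sub_one ha'.ne']; field_simp
    rw [e1] at h1
    linear_combination h1 + p * e3 + ε * e4 + C * e2

/-- A prescribed lower bound for each new term of a sequence, depending on the previous terms, is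
met by some strictly increasing sequence. -/
lemma exists_strictMono_forall_image_range_le (N : Finset ℕ → ℕ) :
    ∃ φ : ℕ → ℕ, StrictMono φ ∧ ∀ k, N ((Finset.range k).image φ) ≤ φ k := by
  -- The second entry exceeds all earlier values, which forces strict monotonicity.
  let c : Finset ℕ → ℕ := fun F => max (N F) (F.sup id + 1)
  let T : ℕ → Finset ℕ := fun k => Nat.rec ∅ (fun _ F => insert (c F) F) k
  have hT : ∀ k, T (k + 1) = insert (c (T k)) (T k) := fun k => rfl
  have himg : ∀ k, (Finset.range k).image (fun j => c (T j)) = T k := by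
    intro k
    induction k with
    | zero => rfl
    | succ k ih => rw [Finset.range_add_one, Finset.image_insert, ih, hT]
  refine ⟨fun k => c (T k), strictMono_nat_of_lt_succ fun k => ?_, fun k => ?_⟩
  · have h1 : c (T k) ≤ (T (k + 1)).sup id :=
      Finset.le_sup (f := id) (by rw [hT]; exact Finset.mem_insert_self _ _)
    exact (Nat.lt_succ_of_le h1).trans_le (le_max_right _ _)
  · rw [himg]
    exact le_max_left _ _

/-! ### The case `1 < p < ∞` -/

section Lp

variable {X : Type*} [MeasurableSpace X] {μ : Measure X} {p : ℝ≥0∞}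

lemma one_lt_toReal (hp1 : 1 < p) (hp : p ≠ ∞) : 1 < p.toReal := by
  simpa using (ENNReal.toReal_lt_toReal ENNReal.one_ne_top hp).2 hp1

lemma Lp_integrable_abs_rpow (hp1 : 1 < p) (hp : p ≠ ∞) (g : Lp ℝ p μ) :
    Integrable (fun x => |g x| ^ p.toReal) μ := by
  simpa using (Lp.memLp g).integrable_norm_rpow (zero_lt_one.trans hp1).ne' hp

lemma Lp_norm_rpow_eq_integral (hp1 : 1 < p) (hp : p ≠ ∞) (g : Lp ℝ p μ) :
    ‖g‖ ^ p.toReal = ∫ x, |g x| ^ p.toReal ∂μ := by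
  have hP := one_lt_toReal hp1 hp
  have hnn : 0 ≤ ∫ x, |g x| ^ p.toReal ∂μ := integral_nonneg fun x => by positivity
  rw [Lp.norm_def, (Lp.memLp g).eLpNorm_eq_integral_rpow_norm (zero_lt_one.trans hp1).ne' hp]
  simp only [Real.norm_eq_abs]
  rw [ENNReal.toReal_ofReal (by positivity), ← Real.rpow_mul hnn,
    inv_mul_cancel₀ (by linarith), Real.rpow_one]

lemma eLpNorm_rpowDual (hp1 : 1 < p) (hp : p ≠ ∞) (g : X → ℝ) :
    eLpNorm (fun x => rpowDual p.toReal (g x)) (ENNReal.conjExponent p) μ =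
      eLpNorm g p μ ^ (p.toReal - 1) := by
  have hP := one_lt_toReal hp1 hp
  have h1 : ENNReal.conjExponent p * ENNReal.ofReal (p.toReal - 1) = p := by
    rw [ENNReal.ofReal_sub _ zero_le_one, ENNReal.ofReal_toReal hp, ENNReal.ofReal_one,
      ENNReal.conjExponent, add_mul, one_mul, ENNReal.inv_mul_cancel (tsub_pos_of_lt hp1).ne'
      (ENNReal.sub_ne_top hp), tsub_add_cancel_of_le hp1.le]
  have h2 := eLpNorm_norm_rpow (p := ENNReal.conjExponent p) (μ := μ) g (sub_pos.2 hP)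
  rw [h1] at h2
  rw [← h2]
  refine eLpNorm_congr_norm_ae (.of_forall fun x => ?_)
  rw [Real.norm_eq_abs, abs_rpowDual hP, Real.norm_of_nonneg (by positivity), Real.norm_eq_abs]

lemma memLp_rpowDual (hp1 : 1 < p) (hp : p ≠ ∞) (g : Lp ℝ p μ) :
    MemLp (fun x => rpowDual p.toReal (g x)) (ENNReal.conjExponent p) μ := by
  refine ⟨((measurable_rpowDual _).comp_aemeasurable
    (Lp.aestronglyMeasurable g).aemeasurable).aestronglyMeasurable, ?_⟩
  rw [eLpNorm_rpowDual hp1 hp]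
  have := one_lt_toReal hp1 hp
  exact ENNReal.rpow_lt_top_of_nonneg (by linarith) (Lp.eLpNorm_ne_top g)

/-- Banach–Steinhaus bounds the functionals on `L^q`; testing the `i`-th one on `rpowDual (f i)`, of
norm `‖f i‖ ^ (p - 1)`, recovers `‖f i‖`. -/
lemma exists_norm_le_of_weak_tendsto_zero [Fact (1 ≤ p)] (hp1 : 1 < p) (hp : p ≠ ∞)
    {f : ℕ → Lp ℝ p μ} (hf : ∀ v : Lp ℝ (ENNReal.conjExponent p) μ,
      Tendsto (fun i => ∫ x, f i x * v x ∂μ) atTop (𝓝 0)) :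
    ∃ M, ∀ i, ‖f i‖ ≤ M := by
  have hP := one_lt_toReal hp1 hp
  have : Fact (1 ≤ ENNReal.conjExponent p) := ⟨by simp [ENNReal.conjExponent]⟩
  let T : ℕ → Lp ℝ (ENNReal.conjExponent p) μ →L[ℝ] ℝ := fun i =>
    (ContinuousLinearMap.mul ℝ ℝ).lpPairing μ p (ENNReal.conjExponent p) (f i)
  have hT : ∀ i v, T i v = ∫ x, f i x * v x ∂μ := fun i v => by
    simp only [T, ContinuousLinearMap.lpPairing_eq_integral, ContinuousLinearMap.mul_apply']
  obtain ⟨C, hC⟩ := banach_steinhaus (g := T) fun v => by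
    have := (hf v).norm.bddAbove_range
    obtain ⟨c, hc⟩ := this
    refine ⟨c, fun i => ?_⟩
    rw [hT]
    exact hc ⟨i, rfl⟩
  refine ⟨C, fun i => ?_⟩
  rcases (norm_nonneg (f i)).eq_or_lt with h0 | h0
  · rw [← h0]; exact (norm_nonneg _).trans (hC 0)
  set v := (memLp_rpowDual hp1 hp (f i)).toLp
  have hv : ‖v‖ = ‖f i‖ ^ (p.toReal - 1) := by
    rw [Lp.norm_toLp, eLpNorm_rpowDual hp1 hp, ← ENNReal.toReal_rpow, Lp.norm_def]
  have h1 : T i v = ‖f i‖ ^ p.toReal := by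
    rw [hT, Lp_norm_rpow_eq_integral hp1 hp]
    refine integral_congr_ae ?_
    filter_upwards [(memLp_rpowDual hp1 hp (f i)).coeFn_toLp] with x hx
    rw [hx, mul_rpowDual (by linarith)]
  have h2 : T i v ≤ C * ‖v‖ := (le_abs_self _).trans <|
    ((T i).le_opNorm v).trans (mul_le_mul_of_nonneg_right (hC i) (norm_nonneg _))
  rw [h1, hv] at h2
  have h3 : ‖f i‖ ^ p.toReal = ‖f i‖ * ‖f i‖ ^ (p.toReal - 1) := by
    rw [Real.rpow_sub_one h0.ne']; field_simp
  rw [h3] at h2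
  exact le_of_mul_le_mul_right h2 (by positivity)

lemma Lp_norm_add_rpow_le [Fact (1 ≤ p)] (hp1 : 1 < p) (hp : p ≠ ∞) {ε C : ℝ} (hε : 0 ≤ ε)
    (h : ∀ a b : ℝ, |a + b| ^ p.toReal ≤ |a| ^ p.toReal + p.toReal * (rpowDual p.toReal a * b) +
      ε * (|a| ^ (p.toReal - 1) * |b|) + C * |b| ^ p.toReal)
    {t A : ℝ} (ht : 0 < t) (s f : Lp ℝ p μ) (hs : ‖s‖ ≤ t * A) (hfA : ‖f‖ ≤ A)
    (hC : 0 ≤ C) :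
    ‖s + f‖ ^ p.toReal ≤ ‖s‖ ^ p.toReal + p.toReal * ∫ x, rpowDual p.toReal (s x) * f x ∂μ +
      ε * (t ^ (p.toReal - 1) * (2 * A ^ p.toReal)) + C * A ^ p.toReal := by
  set P := p.toReal
  have hP : 1 < P := one_lt_toReal hp1 hp
  have hA : 0 ≤ A := (norm_nonneg _).trans hfA
  have is := Lp_integrable_abs_rpow hp1 hp s
  have ib := Lp_integrable_abs_rpow hp1 hp f
  -- A crude scaled Young inequality replaces Hölder: `r = 1` gives integrability, `r = t` balances
  -- the two norms.
  have young : ∀ r : ℝ, 0 < r → ∀ a b : ℝ, |a| ^ (P - 1) * |b| ≤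
      r ^ (P - 1) * ((r ^ P)⁻¹ * |a| ^ P + |b| ^ P) := by
    intro r hr a b
    have key : ∀ c d : ℝ, 0 ≤ c → 0 ≤ d → c ^ (P - 1) * d ≤ c ^ P + d ^ P := by
      intro c d hc hd
      have e : ∀ y : ℝ, 0 ≤ y → y ^ (P - 1) * y = y ^ P := by
        intro y hy
        rcases hy.eq_or_lt with rfl | hy
        · simp [Real.zero_rpow (by linarith : P ≠ 0)]
        · rw [Real.rpow_sub_one hy.ne']; field_simp
      have hc' : 0 ≤ c ^ P := by positivity
      have hd' : 0 ≤ d ^ P := by positivity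
      rcases le_total c d with hcd | hcd
      · have := mul_le_mul_of_nonneg_right (Real.rpow_le_rpow hc hcd (by linarith : 0 ≤ P - 1)) hd
        rw [e d hd] at this
        linarith
      · have := mul_le_mul_of_nonneg_left hcd (by positivity : 0 ≤ c ^ (P - 1))
        rw [e c hc] at this
        linarith
    have h1 := mul_le_mul_of_nonneg_left (key (|a| / r) |b| (by positivity) (by positivity))
      (by positivity : 0 ≤ r ^ (P - 1))
    rw [Real.div_rpow (abs_nonneg a) hr.le, Real.div_rpow (abs_nonneg a) hr.le] at h1
    have h2 : r ^ (P - 1) * (|a| ^ (P - 1) / r ^ (P - 1) * |b|) = |a| ^ (P - 1) * |b| := by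
      have : r ^ (P - 1) ≠ 0 := by positivity
      field_simp
    rw [h2, div_eq_inv_mul] at h1
    exact h1
  have mS : AEMeasurable s μ := (Lp.aestronglyMeasurable s).aemeasurable
  have mF : AEMeasurable f μ := (Lp.aestronglyMeasurable f).aemeasurable
  have i2 : Integrable (fun x => |s x| ^ (P - 1) * |f x|) μ := by
    refine Integrable.mono' (((is.const_mul ((1 : ℝ) ^ P)⁻¹).add ib).const_mul ((1 : ℝ) ^ (P - 1)))
      (by fun_prop) (.of_forall fun x => ?_)
    rw [Real.norm_of_nonneg (by positivity)]
    exact young 1 one_pos _ _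
  have i1 : Integrable (fun x => rpowDual P (s x) * f x) μ := by
    refine Integrable.mono' i2
      (((measurable_rpowDual P).comp_aemeasurable mS).mul mF).aestronglyMeasurable
      (.of_forall fun x => ?_)
    rw [norm_mul, Real.norm_eq_abs, Real.norm_eq_abs, abs_rpowDual hP]
  have b2 : ∫ x, |s x| ^ (P - 1) * |f x| ∂μ ≤ t ^ (P - 1) * (2 * A ^ P) := by
    calc ∫ x, |s x| ^ (P - 1) * |f x| ∂μ
        ≤ ∫ x, t ^ (P - 1) * ((t ^ P)⁻¹ * |s x| ^ P + |f x| ^ P) ∂μ :=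
          integral_mono i2 (((is.const_mul _).add ib).const_mul _) fun x => young t ht _ _
      _ = t ^ (P - 1) * ((t ^ P)⁻¹ * ‖s‖ ^ P + ‖f‖ ^ P) := by
          rw [integral_const_mul, integral_add (is.const_mul _) ib, integral_const_mul,
            Lp_norm_rpow_eq_integral hp1 hp, Lp_norm_rpow_eq_integral hp1 hp]
      _ ≤ t ^ (P - 1) * (2 * A ^ P) := by
          have h1 : ‖s‖ ^ P ≤ t ^ P * A ^ P := by
            rw [← Real.mul_rpow ht.le hA]
            exact Real.rpow_le_rpow (norm_nonneg _) hs (by linarith)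
          have h2 : ‖f‖ ^ P ≤ A ^ P := Real.rpow_le_rpow (norm_nonneg _) hfA (by linarith)
          have h3 : (t ^ P)⁻¹ * ‖s‖ ^ P ≤ A ^ P := by
            rw [inv_mul_le_iff₀ (by positivity)]; exact h1
          gcongr
          linarith
  have b3 : ‖f‖ ^ P ≤ A ^ P := Real.rpow_le_rpow (norm_nonneg _) hfA (by linarith)
  have main : ‖s + f‖ ^ P ≤ ‖s‖ ^ P + P * ∫ x, rpowDual P (s x) * f x ∂μ +
      ε * (∫ x, |s x| ^ (P - 1) * |f x| ∂μ) + C * ‖f‖ ^ P := by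
    have j1 : Integrable (fun x => |s x| ^ P + P * (rpowDual P (s x) * f x)) μ :=
      is.add (i1.const_mul _)
    have j2 : Integrable (fun x => |s x| ^ P + P * (rpowDual P (s x) * f x) +
      ε * (|s x| ^ (P - 1) * |f x|)) μ := j1.add (i2.const_mul _)
    rw [Lp_norm_rpow_eq_integral hp1 hp, Lp_norm_rpow_eq_integral hp1 hp,
      Lp_norm_rpow_eq_integral hp1 hp, ← integral_const_mul, ← integral_const_mul,
      ← integral_const_mul, ← integral_add is (i1.const_mul _),
      ← integral_add j1 (i2.const_mul _), ← integral_add j2 (ib.const_mul _)]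
    refine integral_mono_ae (Lp_integrable_abs_rpow hp1 hp _) (j2.add (ib.const_mul _)) ?_
    filter_upwards [Lp.coeFn_add s f] with x hx
    rw [hx]
    exact h _ _
  have := mul_le_mul_of_nonneg_left b2 hε
  have := mul_le_mul_of_nonneg_left b3 hC
  linarith

/-- The Banach–Saks property of `L^p`, `1 < p < ∞`, with an explicit criterion for the
subsequence: each new index only has to be large in terms of the previous ones. -/
theorem Lp_banachSaks_of_one_lt [Fact (1 ≤ p)] (hp1 : 1 < p) (hp : p ≠ ∞)
    {f : ℕ → Lp ℝ p μ} (hf : ∀ v : Lp ℝ (ENNReal.conjExponent p) μ,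
      Tendsto (fun i => ∫ x, f i x * v x ∂μ) atTop (𝓝 0)) :
    ∃ N : Finset ℕ → ℕ, ∀ φ : ℕ → ℕ, StrictMono φ →
      (∀ k, N ((Finset.range k).image φ) ≤ φ k) →
      Tendsto (fun k : ℕ => ‖(k : ℝ)⁻¹ • ∑ r ∈ Finset.range k, f (φ r)‖) atTop (𝓝 0) := by
  have hP : 1 < p.toReal := one_lt_toReal hp1 hp
  obtain ⟨M, hM⟩ := exists_norm_le_of_weak_tendsto_zero hp1 hp hf
  have hM0 : 0 ≤ M := (norm_nonneg _).trans (hM 0)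
  have hN : ∀ F : Finset ℕ, ∃ N : ℕ, ∀ n ≥ N,
      ∫ x, rpowDual p.toReal ((∑ r ∈ F, f r : Lp ℝ p μ) x) * f n x ∂μ ≤ 1 := by
    intro F
    have h1 := hf (memLp_rpowDual hp1 hp (∑ r ∈ F, f r)).toLp
    have h2 := h1.eventually (eventually_le_nhds one_pos)
    obtain ⟨N, hN⟩ := eventually_atTop.1 h2
    refine ⟨N, fun n hn => le_of_eq_of_le (integral_congr_ae ?_) (hN n hn)⟩
    filter_upwards [(memLp_rpowDual hp1 hp (∑ r ∈ F, f r)).coeFn_toLp] with x hx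
    rw [hx, mul_comm]
  choose N hN using hN
  refine ⟨N, fun φ hφ hNφ => ?_⟩
  set P := p.toReal
  set s : ℕ → Lp ℝ p μ := fun k => ∑ r ∈ Finset.range k, f (φ r) with hs
  have hsn : ∀ k, ‖s k‖ ≤ k * M := fun k =>
    (norm_sum_le_of_le _ fun r _ => hM _).trans (by simp)
  have hstep : ∀ j, ∫ x, rpowDual P (s j x) * f (φ j) x ∂μ ≤ 1 := by
    intro j
    have := hN _ _ (hNφ j)
    rwa [Finset.sum_image hφ.injective.injOn] at this
  have hbound : ∀ ε > 0, ∃ B : ℝ, ∀ k : ℕ, 0 < k →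
      ‖s k‖ ^ P ≤ k * B + 2 * ε * M ^ P * k ^ P := by
    intro ε hε
    obtain ⟨C, hC, h⟩ := exists_abs_add_rpow_le hP hε
    refine ⟨P + C * M ^ P, fun k hk => ?_⟩
    have hk0 : (0 : ℝ) < k := by exact_mod_cast hk
    -- The increment uses the final `k`, not `j`, so it is the same at every step.
    have hind : ∀ j ≤ k, ‖s j‖ ^ P ≤
        j * (P + C * M ^ P + ε * ((k : ℝ) ^ (P - 1) * (2 * M ^ P))) := by
      intro j
      induction j with
      | zero => intro _; simp [hs, Real.zero_rpow (by linarith : P ≠ 0)]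
      | succ j ih =>
        intro hj
        have h1 := ih (by omega)
        have h2 : ‖s j‖ ≤ k * M := (hsn j).trans (by gcongr; omega)
        have h3 := Lp_norm_add_rpow_le hp1 hp hε.le h hk0 (s j) (f (φ j)) h2 (hM _) hC
        have h4 : s (j + 1) = s j + f (φ j) := Finset.sum_range_succ _ _
        have h5 := mul_le_mul_of_nonneg_left (hstep j) (by linarith : 0 ≤ P)
        rw [h4]
        push_cast
        linarith
    have h1 := hind k le_rfl
    have h2 : (k : ℝ) ^ P = k * k ^ (P - 1) := by
      rw [Real.rpow_sub_one hk0.ne']; field_simp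
    rw [h2]
    linear_combination h1
  have hlim : Tendsto (fun k : ℕ => ‖(k : ℝ)⁻¹ • s k‖ ^ P) atTop (𝓝 0) := by
    rw [Metric.tendsto_atTop]
    intro η hη
    have hε : 0 < η / (4 * (M ^ P + 1)) := by positivity
    obtain ⟨B, hB⟩ := hbound _ hε
    have h0 : Tendsto (fun k : ℕ => B * (k : ℝ) ^ (-(P - 1))) atTop (𝓝 0) := by
      simpa using ((tendsto_rpow_neg_atTop (sub_pos.2 hP)).comp
        tendsto_natCast_atTop_atTop).const_mul B
    obtain ⟨K, hK⟩ := eventually_atTop.1 (h0.eventually (eventually_lt_nhds (half_pos hη)))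
    refine ⟨max K 1, fun k hk => ?_⟩
    have hk1 : 0 < k := by have := le_of_max_le_right hk; omega
    have hk0 : (0 : ℝ) < k := by exact_mod_cast hk1
    have h1 := hK k (le_of_max_le_left hk)
    have h2 := hB k hk1
    rw [Real.dist_eq, sub_zero, abs_of_nonneg (by positivity), norm_smul, norm_inv,
      RCLike.norm_natCast, Real.mul_rpow (by positivity) (norm_nonneg _),
      Real.inv_rpow hk0.le, inv_mul_lt_iff₀ (by positivity)]
    have h3 : (k : ℝ) ^ P * (B * (k : ℝ) ^ (-(P - 1))) = k * B := by
      rw [mul_left_comm, ← Real.rpow_add hk0]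
      simp [mul_comm]
    have h4 : 2 * (η / (4 * (M ^ P + 1))) * M ^ P ≤ η / 2 := by
      have : 0 ≤ M ^ P := by positivity
      rw [← sub_nonneg]
      have e : η / 2 - 2 * (η / (4 * (M ^ P + 1))) * M ^ P = η / (2 * (M ^ P + 1)) := by
        field_simp; ring
      rw [e]; positivity
    have hkP : 0 < (k : ℝ) ^ P := by positivity
    nlinarith [mul_lt_mul_of_pos_left h1 hkP, mul_le_mul_of_nonneg_right h4 hkP.le]
  have h1 := hlim.rpow_const (p := P⁻¹) (Or.inr (by positivity))
  rw [Real.zero_rpow (by positivity)] at h1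
  refine h1.congr fun k => ?_
  rw [← Real.rpow_mul (norm_nonneg _), mul_inv_cancel₀ (by positivity), Real.rpow_one]

end Lp

/-! ### The case `p = 1` on a finite measure space -/

section FiniteMeasure

variable {X : Type*} [MeasurableSpace X] {ν : Measure X}

lemma measurable_ite_nonneg {g : X → ℝ} (hg : Measurable g) :
    Measurable fun x => if 0 ≤ g x then (1 : ℝ) else -1 :=
  Measurable.ite (measurableSet_le measurable_const hg) measurable_const measurable_const

/-- The uniform bound on `B` gives the dominating function `|g|`; `L^1` convergence gives a.e.
convergence along a further subsequence. -/
lemma continuous_integral_mul_of_bounded {B : Set (Lp ℝ 1 ν)}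
    (hB : ∀ v ∈ B, ∀ᵐ x ∂ν, |v x| ≤ 1) {g : X → ℝ} (hg : Integrable g ν) :
    Continuous fun v : B => ∫ x, g x * (v : Lp ℝ 1 ν) x ∂ν := by
  refine continuous_iff_seqContinuous.2 fun v w hvw => ?_
  refine tendsto_of_subseq_tendsto fun ns hns => ?_
  have h1 : Tendsto (fun k => (v (ns k) : Lp ℝ 1 ν)) atTop (𝓝 (w : Lp ℝ 1 ν)) :=
    (continuous_subtype_val.tendsto _).comp (hvw.comp hns)
  obtain ⟨ms, hms, hae⟩ := (tendstoInMeasure_of_tendsto_Lp h1).exists_seq_tendsto_ae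
  refine ⟨ms, tendsto_integral_of_dominated_convergence (fun x => |g x|)
    (fun k => hg.1.mul (Lp.aestronglyMeasurable _)) hg.abs (fun k => ?_) ?_⟩
  · filter_upwards [hB _ (v (ns (ms k))).2] with x hx
    rw [norm_mul, Real.norm_eq_abs, Real.norm_eq_abs]
    exact mul_le_of_le_one_right (abs_nonneg _) hx
  · filter_upwards [hae] with x hx
    exact hx.const_mul _

/-- A sequence that tends to zero weakly in `L^1` of a finite measure is equi-integrable, up to
finitely many terms. -/
lemma equiintegrable_of_weak_tendsto_zero [IsFiniteMeasure ν] {f : ℕ → X → ℝ}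
    (hfm : ∀ i, Measurable (f i)) (hfi : ∀ i, Integrable (f i) ν)
    (hf : ∀ v : X → ℝ, Measurable v → (∀ x, |v x| ≤ 1) →
      Tendsto (fun i => ∫ x, f i x * v x ∂ν) atTop (𝓝 0)) {ε : ℝ} (hε : 0 < ε) :
    ∃ δ > 0, ∃ N, ∀ n ≥ N, ∀ c : X → ℝ, Measurable c → (∀ x, 0 ≤ c x) → (∀ x, c x ≤ 1) →
      ∫ x, c x ∂ν < δ → ∫ x, c x * |f n x| ∂ν ≤ ε := by
  -- Baire's theorem is applied to the unit ball of `L^∞` with the `L^1` metric: it is the order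
  -- interval `[-o, o]`, closed in `L^1` and hence complete.
  let o : Lp ℝ 1 ν := (memLp_const (1 : ℝ)).toLp
  have ho : o =ᵐ[ν] fun _ => 1 := MemLp.coeFn_toLp _
  have hmem : ∀ v : Lp ℝ 1 ν, v ∈ Set.Icc (-o) o ↔ ∀ᵐ x ∂ν, |v x| ≤ 1 := by
    intro v
    rw [Set.mem_Icc, ← Lp.coeFn_le, ← Lp.coeFn_le]
    constructor
    · rintro ⟨h1, h2⟩
      filter_upwards [h1, h2, ho, Lp.coeFn_neg o] with x h1 h2 h3 h4
      rw [h4, Pi.neg_apply, h3] at h1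
      rw [h3] at h2
      exact abs_le.2 ⟨h1, h2⟩
    · intro h
      constructor
      · filter_upwards [h, ho, Lp.coeFn_neg o] with x h h3 h4
        rw [h4, Pi.neg_apply, h3]
        exact (abs_le.1 h).1
      · filter_upwards [h, ho] with x h h3
        rw [h3]
        exact (abs_le.1 h).2
  set B : Set (Lp ℝ 1 ν) := Set.Icc (-o) o
  have hBle : ∀ v ∈ B, ∀ᵐ x ∂ν, |v x| ≤ 1 := fun v hv => (hmem v).1 hv
  have hrep : ∀ v ∈ B, ∃ w : X → ℝ, Measurable w ∧ (∀ x, |w x| ≤ 1) ∧ v =ᵐ[ν] w := by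
    intro v hv
    refine ⟨fun x => max (-1) (min 1 (v x)), ?_, fun x => ?_, ?_⟩
    · exact measurable_const.max (measurable_const.min (Lp.stronglyMeasurable v).measurable)
    · exact abs_le.2 ⟨le_max_left _ _, max_le (by norm_num) (min_le_left _ _)⟩
    · filter_upwards [hBle v hv] with x hx
      rw [min_eq_right (abs_le.1 hx).2, max_eq_right (abs_le.1 hx).1]
  have hmemLp : ∀ w : X → ℝ, Measurable w → (∀ x, |w x| ≤ 1) → MemLp w 1 ν := fun w hw hw1 =>
    MemLp.of_bound hw.aestronglyMeasurable 1 (.of_forall fun x => hw1 x)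
  let A : ℕ → Set B := fun N => {v | ∀ n ≥ N, |∫ x, f n x * (v : Lp ℝ 1 ν) x ∂ν| ≤ ε / 2}
  have hclosed : ∀ N, IsClosed (A N) := by
    intro N
    simp only [A, Set.ofPred_forall]
    exact isClosed_iInter fun n => isClosed_iInter fun _ =>
      isClosed_le (continuous_integral_mul_of_bounded hBle (hfi n)).abs continuous_const
  have hunion : ⋃ N, A N = Set.univ := by
    refine Set.eq_univ_of_forall fun v => ?_
    obtain ⟨w, hw, hw1, hvw⟩ := hrep v v.2
    have h1 := (hf w hw hw1).abs
    rw [abs_zero] at h1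
    obtain ⟨N, hN⟩ := eventually_atTop.1 (h1.eventually (eventually_le_nhds (half_pos hε)))
    refine Set.mem_iUnion.2 ⟨N, fun n hn => ?_⟩
    rw [integral_congr_ae (g := fun x => f n x * w x)
      (by filter_upwards [hvw] with x hx; rw [hx])]
    exact hN n hn
  have : Nonempty B := ⟨⟨(memLp_const (0 : ℝ)).toLp, (hmem _).2 (by
    filter_upwards [MemLp.coeFn_toLp (memLp_const (μ := ν) (p := 1) (0 : ℝ))] with x hx
    rw [hx]; simp)⟩⟩
  have : CompleteSpace B := isClosed_Icc.completeSpace_coe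
  obtain ⟨N, v0, hv0⟩ := nonempty_interior_of_iUnion_of_closed hclosed hunion
  obtain ⟨r, hr, hball⟩ := Metric.mem_nhds_iff.1 (mem_interior_iff_mem_nhds.1 hv0)
  obtain ⟨w0, hw0, hw01, hvw0⟩ := hrep v0 v0.2
  refine ⟨r / 2, by positivity, N, fun n hn c hc hc0 hc1 hcr => ?_⟩
  have hci : Integrable c ν := memLp_one_iff_integrable.1
    (hmemLp c hc fun x => abs_le.2 ⟨by linarith [hc0 x], hc1 x⟩)
  have key : ∀ w : X → ℝ, Measurable w → (∀ x, |w x| ≤ 1) → (∀ x, |w x - w0 x| ≤ 2 * c x) →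
      |∫ x, f n x * w x ∂ν| ≤ ε / 2 := by
    intro w hw hw1 hww
    have hL := (hmemLp w hw hw1).coeFn_toLp
    let u : B := ⟨(hmemLp w hw hw1).toLp, (hmem _).2 (by
      filter_upwards [hL] with x hx; rw [hx]; exact hw1 x)⟩
    have hd : dist u v0 < r := by
      rw [Subtype.dist_eq, dist_eq_norm, L1.norm_eq_integral_norm]
      refine lt_of_le_of_lt (b := ∫ x, 2 * c x ∂ν) (integral_mono_ae
        (L1.integrable_coeFn _).norm (hci.const_mul 2) ?_) ?_
      · filter_upwards [hL, hvw0, Lp.coeFn_sub (u : Lp ℝ 1 ν) (v0 : Lp ℝ 1 ν)] with x h1 h2 h3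
        rw [h3, Pi.sub_apply, h2, h1]
        exact hww x
      · rw [integral_const_mul]; linarith
    have h1 := hball hd n hn
    rwa [integral_congr_ae (g := fun x => f n x * w x)
      (by filter_upwards [hL] with x hx; rw [← hx])] at h1
  have hsg : ∀ y : ℝ, |(if 0 ≤ y then (1 : ℝ) else -1)| = 1 := by intro y; split_ifs <;> simp
  have hsm : ∀ y : ℝ, y * (if 0 ≤ y then (1 : ℝ) else -1) = |y| := by
    intro y
    split_ifs with h
    · rw [abs_of_nonneg h, mul_one]
    · rw [abs_of_neg (not_le.1 h)]; ring
  let sg : X → ℝ := fun x => if 0 ≤ f n x then 1 else -1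
  have hsgm : Measurable sg := measurable_ite_nonneg (hfm n)
  -- Both this function and the next stay in the ball and within `2 * c` of `w0`; their pairings
  -- with `f n` differ by `∫ c * |f n|`.
  have k1 := key (fun x => (1 - c x) * w0 x + c x * sg x) (by fun_prop)
    (fun x => by
      have h1 : |sg x| = 1 := hsg _
      calc _ ≤ |(1 - c x) * w0 x| + |c x * sg x| := abs_add_le _ _
        _ = (1 - c x) * |w0 x| + c x := by
          rw [abs_mul, abs_mul, h1, abs_of_nonneg (hc0 x), abs_of_nonneg (by linarith [hc1 x]),
            mul_one]
        _ ≤ 1 := by nlinarith [hw01 x, hc1 x])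
    (fun x => by
      have h1 : |sg x| = 1 := hsg _
      have e : (1 - c x) * w0 x + c x * sg x - w0 x = c x * (sg x - w0 x) := by ring
      rw [e, abs_mul, abs_of_nonneg (hc0 x), mul_comm]
      refine mul_le_mul_of_nonneg_right ((abs_sub _ _).trans ?_) (hc0 x)
      linarith [hw01 x])
  have k2 := key (fun x => (1 - c x) * w0 x) (by fun_prop)
    (fun x => by
      rw [abs_mul, abs_of_nonneg (by linarith [hc1 x])]
      nlinarith [hw01 x, hc1 x, hc0 x, abs_nonneg (w0 x)])
    (fun x => by
      have e : (1 - c x) * w0 x - w0 x = -(c x * w0 x) := by ring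
      rw [e, abs_neg, abs_mul, abs_of_nonneg (hc0 x)]
      nlinarith [hw01 x, hc0 x])
  have i2 : Integrable (fun x => f n x * ((1 - c x) * w0 x)) ν := by
    refine (hfi n).mul_bdd (c := 1) (by fun_prop) (.of_forall fun x => ?_)
    rw [Real.norm_eq_abs, abs_mul, abs_of_nonneg (by linarith [hc1 x])]
    nlinarith [hw01 x, hc1 x, hc0 x, abs_nonneg (w0 x)]
  have i3 : Integrable (fun x => c x * |f n x|) ν := by
    refine (hfi n).abs.bdd_mul (c := 1) (by fun_prop) (.of_forall fun x => ?_)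
    rw [Real.norm_eq_abs, abs_of_nonneg (hc0 x)]
    exact hc1 x
  have e : ∫ x, f n x * ((1 - c x) * w0 x + c x * sg x) ∂ν =
      ∫ x, f n x * ((1 - c x) * w0 x) ∂ν + ∫ x, c x * |f n x| ∂ν := by
    rw [← integral_add i2 i3]
    congr 1 with x
    have : f n x * sg x = |f n x| := hsm _
    linear_combination c x * this
  rw [e] at k1
  linarith [(abs_le.1 k1).2, (abs_le.1 k2).1]

lemma exists_integral_abs_le_of_weak_tendsto_zero [IsFiniteMeasure ν] {f : ℕ → X → ℝ}
    (hfm : ∀ i, Measurable (f i)) (hfi : ∀ i, Integrable (f i) ν)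
    (hf : ∀ v : X → ℝ, Measurable v → (∀ x, |v x| ≤ 1) →
      Tendsto (fun i => ∫ x, f i x * v x ∂ν) atTop (𝓝 0)) :
    ∃ M N, ∀ n ≥ N, ∫ x, |f n x| ∂ν ≤ M := by
  obtain ⟨δ, hδ, N, h⟩ := equiintegrable_of_weak_tendsto_zero hfm hfi hf one_pos
  set V := ν.real Set.univ
  have hV : 0 ≤ V := measureReal_nonneg
  -- Equi-integrability is applied to the constant weight `t`, whose integral is below `δ`.
  set t := min 1 (δ / (2 * (V + 1)))
  have ht : 0 < t := lt_min one_pos (by positivity)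
  refine ⟨t⁻¹, N, fun n hn => ?_⟩
  have h1 := h n hn (fun _ => t) measurable_const (fun _ => ht.le) (fun _ => min_le_left _ _) (by
    rw [integral_const, smul_eq_mul]
    calc V * t ≤ V * (δ / (2 * (V + 1))) := by gcongr; exact min_le_right _ _
      _ < δ := by
        rw [mul_div_assoc', div_lt_iff₀ (by positivity)]
        nlinarith)
  rw [integral_const_mul] at h1
  rw [← one_div, le_div_iff₀ ht, mul_comm]
  exact h1

/-- For `|b| ≤ 4 * K`, the tangent to the square root at `K ^ 2 + a ^ 2` leaves an error `b ^ 2 / (2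
* K)`. For larger `|b|`, the increment and the linear term are each at most `|b|` in size. -/
lemma sqrt_sq_add_sq_le {K : ℝ} (hK : 0 < K) (a b : ℝ) :
    √(K ^ 2 + (a + b) ^ 2) ≤
      √(K ^ 2 + a ^ 2) + b * (a / √(K ^ 2 + a ^ 2)) + 2 * (min (|b| / (4 * K)) 1 * |b|) := by
  set x := √(K ^ 2 + a ^ 2) with hx
  have hx2 : x ^ 2 = K ^ 2 + a ^ 2 := Real.sq_sqrt (by positivity)
  have hxK : K ≤ x := Real.le_sqrt_of_sq_le (by nlinarith [sq_nonneg a])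
  have hx0 : 0 < x := hK.trans_le hxK
  have hax : |a| ≤ x := Real.abs_le_sqrt (by nlinarith [sq_nonneg K])
  rcases le_total (|b| / (4 * K)) 1 with h | h
  · rw [min_eq_left h]
    have e : 2 * (|b| / (4 * K) * |b|) = b ^ 2 / (2 * K) := by
      rw [← sq_abs b]; field_simp; ring
    rw [e]
    have h1 : √(K ^ 2 + (a + b) ^ 2) ≤ x + (2 * a * b + b ^ 2) / (2 * x) := by
      have e2 : x + (2 * a * b + b ^ 2) / (2 * x) = (K ^ 2 + (a + b) ^ 2 + x ^ 2) / (2 * x) := by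
        rw [hx2]; field_simp; rw [hx2]; ring
      rw [e2, le_div_iff₀ (by positivity)]
      have := Real.sq_sqrt (by positivity : 0 ≤ K ^ 2 + (a + b) ^ 2)
      nlinarith [sq_nonneg (√(K ^ 2 + (a + b) ^ 2) - x)]
    have h2 : (2 * a * b + b ^ 2) / (2 * x) = b * (a / x) + b ^ 2 / (2 * x) := by field_simp
    have h3 : b ^ 2 / (2 * x) ≤ b ^ 2 / (2 * K) := by gcongr
    linarith
  · rw [min_eq_right h]
    have h1 : √(K ^ 2 + (a + b) ^ 2) ≤ x + |b| := by
      refine Real.sqrt_le_iff.2 ⟨by positivity, ?_⟩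
      have : a * b ≤ x * |b| := (le_abs_self _).trans
        (by rw [abs_mul]; exact mul_le_mul_of_nonneg_right hax (abs_nonneg _))
      nlinarith [sq_abs b]
    have h2 : -|b| ≤ b * (a / x) := by
      refine neg_le_of_neg_le ((neg_le_abs _).trans ?_)
      rw [abs_mul, abs_div, abs_of_pos hx0]
      exact mul_le_of_le_one_right (abs_nonneg _) ((div_le_one hx0).2 hax)
    linarith

lemma abs_div_sqrt_le_one (K a : ℝ) : |a / √(K ^ 2 + a ^ 2)| ≤ 1 := by
  rw [abs_div, abs_of_nonneg (Real.sqrt_nonneg _)]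
  exact div_le_one_of_le₀ (Real.abs_le_sqrt (by nlinarith [sq_nonneg K])) (Real.sqrt_nonneg _)

lemma integrable_sqrt_sq_add_sq [IsFiniteMeasure ν] {g : X → ℝ} (hgm : Measurable g)
    (hg : Integrable g ν) (K : ℝ) : Integrable (fun x => √(K ^ 2 + g x ^ 2)) ν := by
  refine Integrable.mono' ((integrable_const |K|).add hg.abs) (by fun_prop)
    (.of_forall fun x => ?_)
  rw [Real.norm_of_nonneg (Real.sqrt_nonneg _)]
  refine Real.sqrt_le_iff.2 ⟨by simp only [Pi.add_apply]; positivity, ?_⟩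
  simp only [Pi.add_apply]
  nlinarith [sq_abs K, sq_abs (g x), mul_nonneg (abs_nonneg K) (abs_nonneg (g x))]

/-- The weak Banach–Saks property of `L^1` of a finite measure, with an explicit criterion for the
subsequence. -/
theorem integral_abs_banachSaks_of_isFiniteMeasure [IsFiniteMeasure ν] {f : ℕ → X → ℝ}
    (hfm : ∀ i, Measurable (f i)) (hfi : ∀ i, Integrable (f i) ν)
    (hf : ∀ v : X → ℝ, Measurable v → (∀ x, |v x| ≤ 1) →
      Tendsto (fun i => ∫ x, f i x * v x ∂ν) atTop (𝓝 0)) :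
    ∃ N : Finset ℕ → ℕ, ∀ φ : ℕ → ℕ, StrictMono φ →
      (∀ k, N ((Finset.range k).image φ) ≤ φ k) →
      Tendsto (fun k : ℕ => (k : ℝ)⁻¹ * ∫ x, |∑ r ∈ Finset.range k, f (φ r) x| ∂ν)
        atTop (𝓝 0) := by
  -- The right `K` depends on the final tolerance, so all `K ≤ F.card` are treated at once, and
  -- every `K` is eventually covered.
  have hN : ∀ F : Finset ℕ, ∃ N : ℕ, ∀ n ≥ N, ∀ K ∈ Finset.range (F.card + 1),
      ∫ x, f n x * ((∑ r ∈ F, f r x) / √((K : ℝ) ^ 2 + (∑ r ∈ F, f r x) ^ 2)) ∂ν ≤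
        1 / ((F.card : ℝ) + 1) := by
    intro F
    refine eventually_atTop.1 ((Filter.eventually_all_finset _).2 fun K _ => ?_)
    exact (hf _ (by fun_prop) fun x => abs_div_sqrt_le_one _ _).eventually
      (eventually_le_nhds (by positivity))
  choose N hN using hN
  refine ⟨N, fun φ hφ hNφ => ?_⟩
  set s : ℕ → X → ℝ := fun k x => ∑ r ∈ Finset.range k, f (φ r) x with hs
  have hsm : ∀ k, Measurable (s k) := fun k => by simp only [hs]; fun_prop
  have hsi : ∀ k, Integrable (s k) ν := fun k => integrable_finsetSum _ fun r _ => hfi _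
  have hstep : ∀ j K : ℕ, K ≤ j →
      ∫ x, f (φ j) x * (s j x / √((K : ℝ) ^ 2 + s j x ^ 2)) ∂ν ≤ 1 / ((j : ℝ) + 1) := by
    intro j K hK
    have h := hN _ _ (hNφ j) K
    rw [Finset.card_image_of_injective _ hφ.injective, Finset.card_range] at h
    have h2 := h (by simp; omega)
    simp only [Finset.sum_image hφ.injective.injOn] at h2
    exact h2
  rw [Metric.tendsto_atTop]
  intro η hη
  -- Each late step costs `3 * ε` and the initial part at most `ε * k`, in total `η * k / 2`.
  set ε := η / 8 with hεdef
  have hε : 0 < ε := by positivity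
  obtain ⟨δ, hδ, N1, h1⟩ := equiintegrable_of_weak_tendsto_zero hfm hfi hf hε
  obtain ⟨M, N2, h2⟩ := exists_integral_abs_le_of_weak_tendsto_zero hfm hfi hf
  have hM : 0 ≤ M := (integral_nonneg fun x => abs_nonneg _).trans (h2 N2 le_rfl)
  -- This makes the integral of the weight `min (|g| / (4 * K)) 1` smaller than `δ`.
  obtain ⟨K', hK'⟩ := exists_nat_gt (M / (4 * δ))
  set K := K' + 1 with hKdef
  have hK0 : (0 : ℝ) < K := by positivity
  have hKδ : M / (4 * K) < δ := by
    rw [div_lt_iff₀ (by positivity)] at hK' ⊢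
    rw [hKdef]; push_cast
    nlinarith
  obtain ⟨J, hJ⟩ := exists_nat_one_div_lt hε
  set j0 := max (max N1 N2) (max K J) with hj0
  have hΦ : ∀ j ≥ j0, ∫ x, √((K : ℝ) ^ 2 + s (j + 1) x ^ 2) ∂ν ≤
      ∫ x, √((K : ℝ) ^ 2 + s j x ^ 2) ∂ν + 3 * ε := by
    intro j hj
    have hj1 : N1 ≤ j := by omega
    have hj2 : N2 ≤ j := by omega
    have hj3 : K ≤ j := by omega
    have hj4 : J ≤ j := by omega
    set g := f (φ j)
    have hgm : Measurable g := hfm _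
    have hgi : Integrable g ν := hfi _
    let c : X → ℝ := fun x => min (|g x| / (4 * K)) 1
    have hcm : Measurable c := (hgm.abs.div_const _).min measurable_const
    have hc0 : ∀ x, 0 ≤ c x := fun x => le_min (by positivity) zero_le_one
    have hc1 : ∀ x, c x ≤ 1 := fun x => min_le_right _ _
    have hci : ∫ x, c x ∂ν < δ := by
      refine lt_of_le_of_lt ?_ hKδ
      calc ∫ x, c x ∂ν ≤ ∫ x, |g x| / (4 * K) ∂ν :=
            integral_mono_of_nonneg (.of_forall hc0) (hgi.abs.div_const _)
              (.of_forall fun x => min_le_left _ _)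
        _ = (∫ x, |g x| ∂ν) / (4 * K) := integral_div _ _
        _ ≤ M / (4 * K) := by
            gcongr
            exact h2 _ (hj2.trans hφ.le_apply)
    have hc := h1 _ (hj1.trans hφ.le_apply) c hcm hc0 hc1 hci
    have i0 := integrable_sqrt_sq_add_sq (hsm j) (hsi j) K
    have i1 : Integrable (fun x => g x * (s j x / √((K : ℝ) ^ 2 + s j x ^ 2))) ν :=
      hgi.mul_bdd (c := 1) ((hsm j).div (measurable_const.add
        ((hsm j).pow_const 2)).sqrt).aestronglyMeasurable
        (.of_forall fun x => abs_div_sqrt_le_one _ _)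
    have i2 : Integrable (fun x => c x * |g x|) ν := by
      refine hgi.abs.bdd_mul (c := 1) (by fun_prop) (.of_forall fun x => ?_)
      rw [Real.norm_eq_abs, abs_of_nonneg (hc0 x)]
      exact hc1 x
    have i01 : Integrable (fun x => √((K : ℝ) ^ 2 + s j x ^ 2) +
      g x * (s j x / √((K : ℝ) ^ 2 + s j x ^ 2))) ν := i0.add i1
    have hmain : ∫ x, √((K : ℝ) ^ 2 + s (j + 1) x ^ 2) ∂ν ≤
        ∫ x, √((K : ℝ) ^ 2 + s j x ^ 2) ∂ν +
        ∫ x, g x * (s j x / √((K : ℝ) ^ 2 + s j x ^ 2)) ∂ν + 2 * ∫ x, c x * |g x| ∂ν := by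
      rw [← integral_const_mul, ← integral_add i0 i1, ← integral_add i01 (i2.const_mul 2)]
      refine integral_mono (integrable_sqrt_sq_add_sq (hsm _) (hsi _) K)
        (i01.add (i2.const_mul 2)) fun x => ?_
      have : s (j + 1) x = s j x + g x := Finset.sum_range_succ _ _
      simp only [this]
      exact sqrt_sq_add_sq_le hK0 _ _
    have h3 := hstep j K hj3
    have h4 : 1 / ((j : ℝ) + 1) ≤ 1 / ((J : ℝ) + 1) := by gcongr
    linarith
  set D := ∫ x, √((K : ℝ) ^ 2 + s j0 x ^ 2) ∂ν
  have hD : 0 ≤ D := integral_nonneg fun x => Real.sqrt_nonneg _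
  have hind : ∀ k ≥ j0, ∫ x, √((K : ℝ) ^ 2 + s k x ^ 2) ∂ν ≤ D + 3 * ε * k := by
    intro k hk
    induction k, hk using Nat.le_induction with
    | base => have : 0 ≤ 3 * ε * j0 := by positivity
              linarith
    | succ k hk ih =>
      have := hΦ k hk
      push_cast
      linarith
  obtain ⟨R, hR⟩ := exists_nat_gt (D / ε)
  refine ⟨max (max j0 R) 1, fun k hk => ?_⟩
  have hk1 : j0 ≤ k := by omega
  have hk2 : R ≤ k := by omega
  have hk3 : 0 < k := by omega
  have hk0 : (0 : ℝ) < k := by exact_mod_cast hk3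
  have h3 : ∫ x, |s k x| ∂ν ≤ D + 3 * ε * k := (integral_mono (hsi k).abs
    (integrable_sqrt_sq_add_sq (hsm k) (hsi k) K)
    fun x => Real.abs_le_sqrt (by nlinarith [sq_nonneg (K : ℝ)])).trans (hind k hk1)
  have h4 : D < ε * k := by
    rw [div_lt_iff₀ hε] at hR
    have : (R : ℝ) ≤ k := by exact_mod_cast hk2
    nlinarith
  have h5 : 0 ≤ ∫ x, |s k x| ∂ν := integral_nonneg fun x => abs_nonneg _
  rw [Real.dist_eq, sub_zero, abs_of_nonneg (by positivity), inv_mul_lt_iff₀ hk0]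
  nlinarith

end FiniteMeasure

/-! ### Arbitrary measures and finitely many components -/

section Assembly

variable {X : Type*} [MeasurableSpace X] {μ : Measure X}

/-- Countably many integrable functions are integrable multiples of a common integrable weight. -/
lemma exists_weight_of_Lp_one (f : ℕ → Lp ℝ 1 μ) :
    ∃ W : X → ℝ≥0∞, Measurable W ∧ ∫⁻ x, W x ∂μ ≠ ∞ ∧
      ∀ᵐ x ∂μ, ∀ n, (W x).toReal * (f n x / (W x).toReal) = f n x := by
  obtain ⟨δ, hδ, hsum⟩ := ENNReal.exists_pos_tsum_mul_lt_of_countable one_ne_zero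
    (fun n => eLpNorm (f n) 1 μ) fun n => Lp.eLpNorm_ne_top (f n)
  have hm : ∀ n, Measurable fun x => ‖f n x‖ₑ * (δ n : ℝ≥0∞) := fun n =>
    (Lp.stronglyMeasurable (f n)).measurable.enorm.mul_const _
  have hW : Measurable fun x => ∑' n, ‖f n x‖ₑ * (δ n : ℝ≥0∞) := Measurable.tsum hm
  have hint : ∫⁻ x, ∑' n, ‖f n x‖ₑ * (δ n : ℝ≥0∞) ∂μ ≠ ∞ := by
    rw [lintegral_tsum fun n => (hm n).aemeasurable]
    refine ne_top_of_le_ne_top ENNReal.one_ne_top (le_of_eq_of_le ?_ hsum.le)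
    refine tsum_congr fun n => ?_
    rw [lintegral_mul_const _ (Lp.stronglyMeasurable (f n)).measurable.enorm,
      eLpNorm_one_eq_lintegral_enorm]
  refine ⟨_, hW, hint, ?_⟩
  filter_upwards [ae_lt_top hW hint] with x hx n
  -- If `W x = 0`, every `f n x` vanishes, so division by zero does no harm.
  rcases eq_or_ne (f n x) 0 with h | h
  · simp [h]
  · refine mul_div_cancel₀ _ (ENNReal.toReal_pos (fun h0 => ?_) hx.ne).ne'
    have := ENNReal.tsum_eq_zero.1 h0 n
    simp [h, (hδ n).ne'] at this

/-- The weak Banach–Saks property of `L^1`, with an explicit criterion for the subsequence. -/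
theorem L1_banachSaks {f : ℕ → Lp ℝ 1 μ}
    (hf : ∀ v : Lp ℝ (ENNReal.conjExponent 1) μ,
      Tendsto (fun i => ∫ x, f i x * v x ∂μ) atTop (𝓝 0)) :
    ∃ N : Finset ℕ → ℕ, ∀ φ : ℕ → ℕ, StrictMono φ →
      (∀ k, N ((Finset.range k).image φ) ≤ φ k) →
      Tendsto (fun k : ℕ => ‖(k : ℝ)⁻¹ • ∑ r ∈ Finset.range k, f (φ r)‖) atTop (𝓝 0) := by
  obtain ⟨W, hW, hint, hWf⟩ := exists_weight_of_Lp_one f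
  have hWlt : ∀ᵐ x ∂μ, W x < ∞ := ae_lt_top hW hint
  -- Dividing by `W` while passing to the measure `W μ` preserves pairings with bounded functions
  -- and `L^1` norms.
  have : IsFiniteMeasure (μ.withDensity W) := isFiniteMeasure_withDensity hint
  have hfm : ∀ i, Measurable (f i) := fun i => (Lp.stronglyMeasurable (f i)).measurable
  have hgm : ∀ i, Measurable fun x => f i x / (W x).toReal := fun i =>
    (hfm i).div hW.ennreal_toReal
  have hgi : ∀ i, Integrable (fun x => f i x / (W x).toReal) (μ.withDensity W) := by
    intro i
    rw [integrable_withDensity_iff_integrable_smul' hW hWlt]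
    refine (L1.integrable_coeFn (f i)).congr ?_
    filter_upwards [hWf] with x hx
    rw [smul_eq_mul, hx]
  obtain ⟨N, hN⟩ := integral_abs_banachSaks_of_isFiniteMeasure hgm hgi (fun v hv hv1 => by
    have hvL : MemLp v (ENNReal.conjExponent 1) μ := by
      have e : ENNReal.conjExponent 1 = ∞ := by simp [ENNReal.conjExponent]
      rw [e]
      exact memLp_top_of_bound hv.aestronglyMeasurable 1 (.of_forall fun x => hv1 x)
    refine (hf hvL.toLp).congr fun i => ?_
    rw [integral_withDensity_eq_integral_toReal_smul hW hWlt]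
    refine integral_congr_ae ?_
    filter_upwards [hWf, hvL.coeFn_toLp] with x hx h2
    rw [h2, smul_eq_mul, ← mul_assoc, hx])
  refine ⟨N, fun φ hφ hNφ => (hN φ hφ hNφ).congr fun k => ?_⟩
  rw [norm_smul, norm_inv, RCLike.norm_natCast, L1.norm_eq_integral_norm,
    integral_withDensity_eq_integral_toReal_smul hW hWlt]
  congr 1
  refine integral_congr_ae ?_
  filter_upwards [hWf, Lp.coeFn_finsetSum (Finset.range k) fun r => f (φ r)] with x hx h2
  rw [h2, Real.norm_eq_abs, Finset.sum_apply, smul_eq_mul,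
    ← abs_of_nonneg (ENNReal.toReal_nonneg : 0 ≤ (W x).toReal), ← abs_mul, Finset.mul_sum,
    abs_of_nonneg ENNReal.toReal_nonneg]
  simp only [hx]

lemma LpWeakTendsto.sub_tendsto_zero {p : ℝ≥0∞} [Fact (1 ≤ p)] {f : ℕ → Lp ℝ p μ}
    {g : Lp ℝ p μ} (h : LpWeakTendsto f g) (v : Lp ℝ (ENNReal.conjExponent p) μ) :
    Tendsto (fun i => ∫ x, (f i - g : Lp ℝ p μ) x * v x ∂μ) atTop (𝓝 0) := by
  have hint : ∀ u : Lp ℝ p μ, Integrable (fun x => u x * v x) μ := fun u =>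
    (Lp.memLp u).integrable_mul (Lp.memLp v)
  have h1 := (h v).sub_const (∫ x, g x * v x ∂μ)
  rw [sub_self] at h1
  refine h1.congr fun i => ?_
  rw [← integral_sub (hint _) (hint _)]
  refine integral_congr_ae ?_
  filter_upwards [Lp.coeFn_sub (f i) g] with x hx
  rw [hx, Pi.sub_apply, sub_mul]

/-- The weak Banach–Saks property of `L^p`, `1 ≤ p < ∞`, with an explicit criterion for the
subsequence. -/
theorem LpWeakTendsto.banachSaks {p : ℝ≥0∞} [Fact (1 ≤ p)] (hp : p ≠ ∞) {f : ℕ → Lp ℝ p μ}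
    {g : Lp ℝ p μ} (h : LpWeakTendsto f g) :
    ∃ N : Finset ℕ → ℕ, ∀ φ : ℕ → ℕ, StrictMono φ →
      (∀ k, N ((Finset.range k).image φ) ≤ φ k) →
      Tendsto (fun k : ℕ => ‖(k : ℝ)⁻¹ • ∑ r ∈ Finset.range k, (f (φ r) - g)‖) atTop (𝓝 0) := by
  rcases (Fact.out : 1 ≤ p).eq_or_lt with rfl | hp1
  · exact L1_banachSaks (f := fun i => f i - g) h.sub_tendsto_zero
  · exact Lp_banachSaks_of_one_lt (f := fun i => f i - g) hp1 hp h.sub_tendsto_zero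

end Assembly

theorem theorem2 {X : Type*} [MeasurableSpace X] (μ : Measure X) (m : ℕ)
    (p : ℝ≥0∞) [Fact (1 ≤ p)] (hp : p ≠ ∞)
    (u : ℕ → LpVec m p μ) (u₀ : LpVec m p μ) (hu : LpVecWeakTendsto u u₀) :
    ∃ φ : ℕ → ℕ, StrictMono φ ∧
      Tendsto (fun k : ℕ => ‖((k : ℝ)⁻¹ • (∑ r ∈ Finset.range k, u (φ r))) - u₀‖) atTop (𝓝 0) := by
  choose N hN using fun j => (hu j).banachSaks hp
  obtain ⟨φ, hφ, hNφ⟩ :=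
    exists_strictMono_forall_image_range_le fun F => Finset.univ.sup fun j => N j F
  refine ⟨φ, hφ, ?_⟩
  have hcomp : ∀ j, Tendsto (fun k : ℕ => (k : ℝ)⁻¹ • ∑ r ∈ Finset.range k, (u (φ r) j - u₀ j))
      atTop (𝓝 0) := fun j => tendsto_zero_iff_norm_tendsto_zero.2 <|
    hN j φ hφ fun k => (Finset.le_sup (f := fun j => N j _) (Finset.mem_univ j)).trans (hNφ k)
  have hvec : Tendsto (fun k : ℕ => (k : ℝ)⁻¹ • ∑ r ∈ Finset.range k, (u (φ r) - u₀))
      atTop (𝓝 0) := by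
    have h := ((PiLp.continuous_toLp p fun _ : Fin m => Lp ℝ p μ).tendsto _).comp
      (tendsto_pi_nhds.2 hcomp)
    refine h.congr fun k => ?_
    ext1 j
    simp
  refine (tendsto_zero_iff_norm_tendsto_zero.1 hvec).congr' ?_
  -- At `k = 0` the mean of `u - u₀` is zero and does not contain the term `-u₀`.
  filter_upwards [eventually_gt_atTop 0] with k hk
  have hk0 : (k : ℝ) ≠ 0 := by exact_mod_cast hk.ne'
  rw [Finset.sum_sub_distrib, Finset.sum_const, Finset.card_range, smul_sub,
    ← Nat.cast_smul_eq_nsmul ℝ, smul_smul, inv_mul_cancel₀ hk0, one_smul]
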